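/- Let $(\Omega,\mathcal F)$ be a measurable space and let $\mathcal P$ be a set of probability measures on it. A set is polar if it is contained in some $A'\in\mathcal F$ with $P(A')=0$ for all $P\in\mathcal P$; a property holds quasi surely (q.s.) if it holds outside a polar set. Let $L^0$ be the space of measurable functions $\Omega\to\mathbb R$ modulo q.s. equality, ordered by q.s. inequality; let $L^\infty\subset L^0$ be the q.s. bounded elements, with norm $\|X\|=\inf\{m\in\mathbb R: P(|X|>m)=0\ \forall P\in\mathcal P\}$, and $L^\infty_+=\{X\in L^\infty: X\ge 0\}$. Fix $W\in L^0$ with $W\ge 1$, and put $L_W=\{X\in L^0: X/W\in L^\infty\}$ with norm $\|X\|_W=\|X/W\|$. Let $\mathcal K\subset L^0$ be a convex cone containing $0$. Define $$\mathcal C=\{X\in L_W: X\le k\text{ for some }k\in\mathcal K\},$$ and for $\lambda\ge 0$ $$\mathcal C_\lambda=\{X\in L_W: X\le k\text{ for some }k\in\mathcal K\text{ with }k\ge-\lambda W\},$$ $$\widetilde{\mathcal C}_\lambda=\{X\in L_W:\ \text{for every }P\in\mathcal P\text{ there is }Y\in\mathcal C_\lambda\text{ with }X=Y\ P\text{-a.s.}\}.$$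 Let $\mathcal P_W$ be the set of probability measures $Q$ on $(\Omega,\mathcal F)$ such that $Q\ll P$ for some $P\in\mathcal P$ and $E_Q[W]<\infty$. Assume that $\mathcal C$ is Fatou closed: whenever $(X_n)$ is a $\|\cdot\|_W$-bounded sequence in $\mathcal C$ with $X_n\to X$ q.s., then $X\in\mathcal C$. Then the following are equivalent. 1. (Sensitive No Arbitrage with Bounded Risk) $\ \bigcup_{\lambda\ge 0}\widetilde{\mathcal C}_\lambda\cap L^\infty_+=\{0\}$. 2. For every non-polar $A\in\mathcal F$ and every integer $n\ge 1$ there are $\delta_n\in(0,1/n]$ and $Q_n\in\mathcal P_W$ such that $Q_n(A)>n\delta_n$ and $E_{Q_n}[X]<\delta_n$ for all $X\in\widetilde{\mathcal C}_n$. -/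

import Mathlib

open MeasureTheory Filter Topology

namespace QuasiSure

variable {Ω : Type*} [MeasurableSpace Ω]

/-- The polar sets of a family `Prs` of probability measures: the subsets of measurable sets that are
null under every `P ∈ Prs`. -/
def IsPolar (Prs : Set (ProbabilityMeasure Ω)) (A : Set Ω) : Prop :=
  ∃ A' : Set Ω, A ⊆ A' ∧ MeasurableSet A' ∧ ∀ P ∈ Prs, (P : Measure Ω) A' = 0

/-- The sum of all measures in `Prs`. It is used only through its null sets, which are exactly the
polar sets (`qsMeasure_eq_zero_iff`), so that `∀ᵐ ω ∂(qsMeasure Prs), p ω` says that `p` holds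
quasi surely. -/
noncomputable def qsMeasure (Prs : Set (ProbabilityMeasure Ω)) : Measure Ω :=
  Measure.sum (fun P : Prs => ((P : ProbabilityMeasure Ω) : Measure Ω))

theorem qsMeasure_eq_zero_iff (Prs : Set (ProbabilityMeasure Ω)) (A : Set Ω) :
    qsMeasure Prs A = 0 ↔ IsPolar Prs A := by
  constructor
  · intro h
    obtain ⟨B, hAB, hB, hB0⟩ := exists_measurable_superset_of_null h
    rw [qsMeasure, Measure.sum_apply_eq_zero' hB] at hB0
    exact ⟨B, hAB, hB, fun P hP => hB0 ⟨P, hP⟩⟩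
  · rintro ⟨B, hAB, hB, hB0⟩
    refine measure_mono_null hAB ?_
    rw [qsMeasure, Measure.sum_apply_eq_zero' hB]
    exact fun P => hB0 P P.2

theorem absolutelyContinuous_qsMeasure {Prs : Set (ProbabilityMeasure Ω)} {P : ProbabilityMeasure Ω}
    (hP : P ∈ Prs) : (P : Measure Ω) ≪ qsMeasure Prs := by
  intro A hA
  obtain ⟨B, hAB, -, hB⟩ := (qsMeasure_eq_zero_iff Prs A).1 hA
  exact measure_mono_null hAB (hB P hP)

/-- The space `L⁰` of measurable real functions modulo quasi sure equality. Its vector space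
structure and its order `≤` (quasi sure inequality) are those of Mathlib. -/
abbrev L0 (Prs : Set (ProbabilityMeasure Ω)) : Type _ := Ω →ₘ[qsMeasure Prs] ℝ

/-- The pointwise quotient `X / Y` in `L⁰`. -/
noncomputable def quot {Prs : Set (ProbabilityMeasure Ω)} (X Y : L0 Prs) : L0 Prs :=
  AEEqFun.mk (fun ω => X ω / Y ω)
    (X.measurable.div Y.measurable).aestronglyMeasurable

/-- The subspace `L^∞` of quasi surely bounded functions. -/
def LInf (Prs : Set (ProbabilityMeasure Ω)) : Set (L0 Prs) :=
  {X | ∃ m : ℝ, ∀ P ∈ Prs, (P : Measure Ω) {ω | m < |X ω|} = 0}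

/-- The quasi surely nonnegative elements of `L^∞`. -/
def LInfPlus (Prs : Set (ProbabilityMeasure Ω)) : Set (L0 Prs) :=
  {X | X ∈ LInf Prs ∧ 0 ≤ X}

/-- The quasi sure supremum norm (used only on `L^∞`). -/
noncomputable def cNorm {Prs : Set (ProbabilityMeasure Ω)} (X : L0 Prs) : ℝ :=
  sInf {m : ℝ | ∀ P ∈ Prs, (P : Measure Ω) {ω | m < |X ω|} = 0}

/-- The weighted space `L_W = {X ∈ L⁰ | X / W ∈ L^∞}`. -/
def LW {Prs : Set (ProbabilityMeasure Ω)} (W : L0 Prs) : Set (L0 Prs) :=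
  {X | quot X W ∈ LInf Prs}

/-- The weighted norm `‖X‖_W = ‖X / W‖` (used only on `L_W`). -/
noncomputable def wNorm {Prs : Set (ProbabilityMeasure Ω)} (W X : L0 Prs) : ℝ :=
  cNorm (quot X W)

/-- A set `Acal ⊆ L_W` is Fatou closed if the quasi sure limit of every `‖·‖_W`-bounded sequence
in `Acal` lies in `Acal`. -/
def FatouClosed {Prs : Set (ProbabilityMeasure Ω)} (W : L0 Prs) (Acal : Set (L0 Prs)) : Prop :=
  Acal ⊆ LW W ∧
  ∀ (X : ℕ → L0 Prs) (Y : L0 Prs), (∀ n, X n ∈ Acal) → (∃ M : ℝ, ∀ n, wNorm W (X n) ≤ M) →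
    (∀ᵐ ω ∂(qsMeasure Prs), Tendsto (fun n => X n ω) atTop (𝓝 (Y ω))) → Y ∈ Acal

/-- The class `𝒞` of claims in `L_W` that are dominated by a payoff in `K`. -/
def claims {Prs : Set (ProbabilityMeasure Ω)} (W : L0 Prs) (K : Set (L0 Prs)) : Set (L0 Prs) :=
  {X | X ∈ LW W ∧ ∃ k ∈ K, X ≤ k}

/-- The payoffs `K_lam` in `K` whose losses are bounded by `lam • W`. -/
def boundedRisk {Prs : Set (ProbabilityMeasure Ω)} (W : L0 Prs) (K : Set (L0 Prs)) (lam : ℝ) :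
    Set (L0 Prs) :=
  {k | k ∈ K ∧ -(lam • W) ≤ k}

/-- The class `𝒞_lam` of claims in `L_W` that are dominated by a payoff in `K_lam`. -/
def claimsBdd {Prs : Set (ProbabilityMeasure Ω)} (W : L0 Prs) (K : Set (L0 Prs)) (lam : ℝ) :
    Set (L0 Prs) :=
  claims W (boundedRisk W K lam)

/-- The projection `j_P` from `L⁰` to the space of `P`-a.s. classes, for `P ∈ Prs`. -/
noncomputable def proj {Prs : Set (ProbabilityMeasure Ω)} (P : Prs) (X : L0 Prs) :
    Ω →ₘ[((P : ProbabilityMeasure Ω) : Measure Ω)] ℝ :=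
  AEEqFun.mk X (X.aestronglyMeasurable.mono_ac (absolutelyContinuous_qsMeasure P.2))

/-- The sensitive version `⋂_{P ∈ Prs} j_P⁻¹ (j_P Acal)` of a set `Acal ⊆ L_W`, where the inverse images
are taken in `L_W`. -/
def sensitiveHull {Prs : Set (ProbabilityMeasure Ω)} (W : L0 Prs) (Acal : Set (L0 Prs)) : Set (L0 Prs) :=
  {X | X ∈ LW W ∧ ∀ P : Prs, X ∈ proj P ⁻¹' (proj P '' Acal)}

/-- Sensitive No Arbitrage with Bounded Risk: the union over `lam ≥ 0` of the sensitive versions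
of `𝒞_lam` meets the nonnegative elements of `L^∞` only in `0`. -/
def SensitiveNABR {Prs : Set (ProbabilityMeasure Ω)} (W : L0 Prs) (K : Set (L0 Prs)) : Prop :=
  (⋃ lam : {r : ℝ // 0 ≤ r}, sensitiveHull W (claimsBdd W K lam)) ∩ LInfPlus Prs = {0}

/-- The probability measures that are dominated by a single element of `Prs` and under which `W` is
integrable. -/
def PW {Prs : Set (ProbabilityMeasure Ω)} (W : L0 Prs) : Set (ProbabilityMeasure Ω) :=
  {Q | (∃ P ∈ Prs, (Q : Measure Ω) ≪ (P : Measure Ω)) ∧ Integrable (fun ω => W ω) (Q : Measure Ω)}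

/-- Expectations of elements of `L_W` under measures in `PW W` are genuine integrals. -/
theorem integrable_of_mem_LW {Prs : Set (ProbabilityMeasure Ω)} {W : L0 Prs} (hW : 1 ≤ W)
    {X : L0 Prs} (hX : X ∈ LW W) {Q : ProbabilityMeasure Ω} (hQ : Q ∈ PW W) :
    Integrable (fun ω => X ω) (Q : Measure Ω) := by
  obtain ⟨⟨P, hP, hQP⟩, hint⟩ := hQ
  obtain ⟨m, hm⟩ := hX
  have hac := absolutelyContinuous_qsMeasure hP
  refine (hint.const_mul m).mono' (X.measurable.aestronglyMeasurable) ?_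
  refine hQP.ae_le ?_
  have h1 : ∀ᵐ ω ∂(P : Measure Ω), ¬ m < |quot X W ω| := measure_eq_zero_iff_ae_notMem.1 (hm P hP)
  have h2 : ∀ᵐ ω ∂(P : Measure Ω), quot X W ω = X ω / W ω := hac.ae_le (AEEqFun.coeFn_mk _ _)
  have h3 : ∀ᵐ ω ∂(P : Measure Ω), 1 ≤ W ω := by
    have ha := hac.ae_le (AEEqFun.coeFn_le.2 hW)
    have hb := hac.ae_le (AEEqFun.coeFn_one (α := Ω) (μ := qsMeasure Prs) (β := ℝ))
    filter_upwards [ha, hb] with ω h h'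
    rw [h'] at h
    exact h
  filter_upwards [h1, h2, h3] with ω h h' h''
  rw [h', not_lt, abs_div, abs_of_pos (by linarith : 0 < W ω), div_le_iff₀ (by linarith)] at h
  exact h

end QuasiSure

open QuasiSure

namespace QuasiSure

variable {Ω : Type*} [MeasurableSpace Ω] {Prs : Set (ProbabilityMeasure Ω)}

/-! No arbitrage gives the measures by a separation that takes place under one prior. For non-polar
`A`, the claim `f = 1_A / n` lies outside the sensitive hull of `𝒞_n`, so some `P` sees no element
of `𝒞_n` equal to `f` a.s. By `exists_mem_claimsBdd_ae_eq_of_tendsto`, `f` is then not even a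
`P`-a.s. limit of elements of `𝒞_n`, hence it lies outside the `L²(P)`-closure of `𝒞_n / W`.
Hahn–Banach (`exists_density_separating`) yields a functional, nonnegative because `𝒞_n` is downward
closed, and normalizing it (`exists_PW_separating`) yields `Q ≪ P`.

Conversely, a nonzero arbitrage `X` exceeds some `1/(m+1)` on a non-polar set, and Markov's
inequality under `Q_n` for large `n` contradicts the two bounds on `δ_n`. -/

/-! ### Quasi sure bounds and the weighted norm. -/

theorem qsMeasure_eq_zero_of_forall {A : Set Ω} (hA : MeasurableSet A)
    (h : ∀ P ∈ Prs, (P : Measure Ω) A = 0) : qsMeasure Prs A = 0 :=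
  (qsMeasure_eq_zero_iff Prs A).2 ⟨A, subset_rfl, hA, h⟩

theorem ae_one_le {W : L0 Prs} (hW : 1 ≤ W) : ∀ᵐ ω ∂(qsMeasure Prs), 1 ≤ W ω := by
  filter_upwards [AEEqFun.coeFn_le.2 hW, AEEqFun.coeFn_one (α := Ω) (μ := qsMeasure Prs) (β := ℝ)]
    with ω h h'
  rw [h'] at h
  exact h

theorem forall_measure_lt_abs_eq_zero_iff (X : L0 Prs) (m : ℝ) :
    (∀ P ∈ Prs, (P : Measure Ω) {ω | m < |X ω|} = 0) ↔
      ∀ᵐ ω ∂(qsMeasure Prs), |X ω| ≤ m := by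
  constructor
  · intro h
    have hmeas : MeasurableSet {ω | m < |X ω|} :=
      measurableSet_lt measurable_const X.measurable.abs
    filter_upwards [measure_eq_zero_iff_ae_notMem.1 (qsMeasure_eq_zero_of_forall hmeas h)]
      with ω hω using not_lt.1 hω
  · intro h P hP
    refine measure_eq_zero_iff_ae_notMem.2 ?_
    filter_upwards [(absolutelyContinuous_qsMeasure hP).ae_le h] with ω hω using not_lt.2 hω

theorem ae_abs_quot_le_iff {W : L0 Prs} (hW : 1 ≤ W) (X : L0 Prs) (m : ℝ) :
    (∀ᵐ ω ∂(qsMeasure Prs), |quot X W ω| ≤ m) ↔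
      ∀ᵐ ω ∂(qsMeasure Prs), |X ω| ≤ m * W ω := by
  have hq : ∀ᵐ ω ∂(qsMeasure Prs), quot X W ω = X ω / W ω := AEEqFun.coeFn_mk _ _
  refine eventually_congr ?_
  filter_upwards [hq, ae_one_le hW] with ω h1 h2
  rw [h1, abs_div, abs_of_pos (by linarith : 0 < W ω), div_le_iff₀ (by linarith)]

theorem mem_LW_iff {W : L0 Prs} (hW : 1 ≤ W) {X : L0 Prs} :
    X ∈ LW W ↔ ∃ m : ℝ, ∀ᵐ ω ∂(qsMeasure Prs), |X ω| ≤ m * W ω :=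
  exists_congr fun m =>
    (forall_measure_lt_abs_eq_zero_iff _ m).trans (ae_abs_quot_le_iff hW X m)

/-- Nonemptiness matters: some probability measure must rule out negative bounds, so that the
infimum is over a set bounded below. For empty `Prs` the infimum is over all of `ℝ` and takes the
default value `0`. -/
theorem wNorm_le {W : L0 Prs} (hW : 1 ≤ W) (hne : Prs.Nonempty) {X : L0 Prs} {m : ℝ}
    (h : ∀ᵐ ω ∂(qsMeasure Prs), |X ω| ≤ m * W ω) : wNorm W X ≤ m := by
  refine csInf_le ⟨0, fun r hr => ?_⟩
    ((forall_measure_lt_abs_eq_zero_iff _ m).2 ((ae_abs_quot_le_iff hW X m).2 h))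
  obtain ⟨P, hP⟩ := hne
  by_contra! hr0
  have huniv : {ω | r < |quot X W ω|} = Set.univ :=
    Set.eq_univ_of_forall fun ω => hr0.trans_le (abs_nonneg _)
  have := hr P hP
  rw [huniv, measure_univ] at this
  exact one_ne_zero this

/-! ### Claims with bounded risk and their sensitive hulls. -/

theorem claimsBdd_subset_LW (W : L0 Prs) (K : Set (L0 Prs)) (c : ℝ) :
    claimsBdd W K c ⊆ LW W := fun _ h => h.1

theorem claimsBdd_of_le {W : L0 Prs} {K : Set (L0 Prs)} {c : ℝ} {X Y : L0 Prs}
    (hX : X ∈ claimsBdd W K c) (hY : Y ∈ LW W) (hYX : Y ≤ X) : Y ∈ claimsBdd W K c := by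
  obtain ⟨-, k, hk, hXk⟩ := hX
  exact ⟨hY, k, hk, hYX.trans hXk⟩

theorem neg_smul_le_iff (W k : L0 Prs) (c : ℝ) :
    -(c • W) ≤ k ↔ ∀ᵐ ω ∂(qsMeasure Prs), -(c * W ω) ≤ k ω := by
  rw [← AEEqFun.coeFn_le]
  refine eventually_congr ?_
  filter_upwards [AEEqFun.coeFn_neg (c • W), AEEqFun.coeFn_smul c W] with ω h1 h2
  rw [h1, Pi.neg_apply, h2, Pi.smul_apply, smul_eq_mul]

theorem zero_mem_LW {W : L0 Prs} (hW : 1 ≤ W) : (0 : L0 Prs) ∈ LW W := by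
  refine (mem_LW_iff hW).2 ⟨0, ?_⟩
  filter_upwards [AEEqFun.coeFn_zero (α := Ω) (μ := qsMeasure Prs) (β := ℝ)] with ω h
  simp [h]

theorem zero_mem_claimsBdd {W : L0 Prs} (hW : 1 ≤ W) (K : PointedCone ℝ (L0 Prs)) {c : ℝ}
    (hc : 0 ≤ c) : (0 : L0 Prs) ∈ claimsBdd W (K : Set (L0 Prs)) c := by
  refine ⟨zero_mem_LW hW, 0, ⟨K.zero_mem, ?_⟩, le_rfl⟩
  rw [neg_smul_le_iff]
  filter_upwards [ae_one_le hW,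
    AEEqFun.coeFn_zero (α := Ω) (μ := qsMeasure Prs) (β := ℝ)] with ω h1 h2
  rw [h2, Pi.zero_apply]
  nlinarith

theorem claimsBdd_mono {W : L0 Prs} (hW : 1 ≤ W) (K : Set (L0 Prs)) {c d : ℝ} (h : c ≤ d) :
    claimsBdd W K c ⊆ claimsBdd W K d := by
  rintro X ⟨hX, k, ⟨hk, hck⟩, hXk⟩
  refine ⟨hX, k, ⟨hk, ?_⟩, hXk⟩
  rw [neg_smul_le_iff] at hck ⊢
  filter_upwards [hck, ae_one_le hW] with ω h1 h2
  nlinarith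

theorem subset_sensitiveHull {W : L0 Prs} {D : Set (L0 Prs)} (hD : D ⊆ LW W) :
    D ⊆ sensitiveHull W D := fun X hX => ⟨hD hX, fun _ => ⟨X, hX, rfl⟩⟩

theorem sensitiveHull_mono (W : L0 Prs) {D E : Set (L0 Prs)} (h : D ⊆ E) :
    sensitiveHull W D ⊆ sensitiveHull W E :=
  fun _ hX => ⟨hX.1, fun P => Set.image_mono h (hX.2 P)⟩

theorem proj_eq_proj_iff (P : Prs) (X Y : L0 Prs) :
    proj P X = proj P Y ↔ (X : Ω → ℝ) =ᵐ[((P : ProbabilityMeasure Ω) : Measure Ω)] Y :=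
  AEEqFun.mk_eq_mk

theorem convex_claimsBdd {W : L0 Prs} (hW : 1 ≤ W) (K : PointedCone ℝ (L0 Prs)) (c : ℝ) :
    Convex ℝ (claimsBdd W (K : Set (L0 Prs)) c) := by
  rintro X ⟨hX, k, ⟨hk, hck⟩, hXk⟩ Y ⟨hY, l, ⟨hl, hcl⟩, hYl⟩ a b ha hb hab
  obtain ⟨m, hm⟩ := (mem_LW_iff hW).1 hX
  obtain ⟨m', hm'⟩ := (mem_LW_iff hW).1 hY
  have hcoe : ∀ U V : L0 Prs, ∀ᵐ ω ∂(qsMeasure Prs),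
      (a • U + b • V : L0 Prs) ω = a * U ω + b * V ω := fun U V => by
    filter_upwards [AEEqFun.coeFn_add (a • U) (b • V), AEEqFun.coeFn_smul a U,
      AEEqFun.coeFn_smul b V] with ω h1 h2 h3
    rw [h1, Pi.add_apply, h2, h3]
    rfl
  refine ⟨(mem_LW_iff hW).2 ⟨a * m + b * m', ?_⟩, a • k + b • l, ⟨?_, ?_⟩, ?_⟩
  · filter_upwards [hcoe X Y, hm, hm'] with ω h1 h2 h3
    rw [h1]
    calc |a * X ω + b * Y ω| ≤ |a * X ω| + |b * Y ω| := abs_add_le _ _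
      _ = a * |X ω| + b * |Y ω| := by rw [abs_mul, abs_mul, abs_of_nonneg ha, abs_of_nonneg hb]
      _ ≤ a * (m * W ω) + b * (m' * W ω) := by gcongr
      _ = (a * m + b * m') * W ω := by ring
  · exact K.add_mem (PointedCone.smul_mem K ha hk) (PointedCone.smul_mem K hb hl)
  · rw [neg_smul_le_iff] at hck hcl ⊢
    filter_upwards [hcoe k l, hck, hcl] with ω h1 h2 h3
    rw [h1]
    calc -(c * W ω) = a * -(c * W ω) + b * -(c * W ω) := by rw [← add_mul, hab, one_mul]
      _ ≤ _ := by gcongr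
  · rw [← AEEqFun.coeFn_le] at hXk hYl ⊢
    filter_upwards [hcoe X Y, hcoe k l, hXk, hYl] with ω h1 h2 h3 h4
    rw [h1, h2]
    gcongr

/-! ### From Fatou closedness to closedness under a single prior. -/

/-- If `claims W K` is Fatou closed, then the class of claims superhedged with risk at most `c • W`
is closed under `P`-a.s. limits in the order interval `[0, W]`, up to a modification of the limit
on a `P`-null set. No bound on the approximating sequence is required. -/
theorem exists_mem_claimsBdd_ae_eq_of_tendsto {W : L0 Prs} (hW : 1 ≤ W) {K : Set (L0 Prs)}
    (hC : FatouClosed W (claims W K)) {P : ProbabilityMeasure Ω} (hP : P ∈ Prs) {c : ℝ}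
    (hc : 1 ≤ c) {X : ℕ → L0 Prs} (hX : ∀ m, X m ∈ claimsBdd W K c) {f : L0 Prs}
    (hf0 : ∀ᵐ ω ∂(qsMeasure Prs), 0 ≤ f ω) (hfW : ∀ᵐ ω ∂(qsMeasure Prs), f ω ≤ W ω)
    (hlim : ∀ᵐ ω ∂(P : Measure Ω), Tendsto (fun m => X m ω) atTop (𝓝 (f ω))) :
    ∃ T ∈ claimsBdd W K c, (f : Ω → ℝ) =ᵐ[(P : Measure Ω)] T := by
  classical
  have hW1 := ae_one_le hW
  obtain ⟨N, hN, hNmeas, hN0⟩ := exists_measurable_superset_of_null (ae_iff.1 hlim)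
  have hNc : ∀ ω ∉ N, Tendsto (fun m => X m ω) atTop (𝓝 (f ω)) := fun ω hω => by
    by_contra h
    exact hω (hN h)
  have hmeasW : Measurable fun ω => -(c * W ω) := (W.measurable.const_mul c).neg
  -- Truncation to `[-cW, W]` supplies the norm bound. On the exceptional set `N` the value `-cW`
  -- turns `P`-a.s. convergence into q.s. convergence, and domination survives there because every
  -- dominating payoff is at least `-cW`.
  let t : ℕ → Ω → ℝ := fun m => N.piecewise (fun ω => -(c * W ω))
    (fun ω => min (max (X m ω) (-(c * W ω))) (W ω))
  let s : Ω → ℝ := N.piecewise (fun ω => -(c * W ω)) f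
  have ht : ∀ m, Measurable (t m) := fun m => Measurable.piecewise hNmeas hmeasW
    (((X m).measurable.max hmeasW).min W.measurable)
  have hs : Measurable s := Measurable.piecewise hNmeas hmeasW f.measurable
  let T : ℕ → L0 Prs := fun m => AEEqFun.mk (t m) (ht m).aestronglyMeasurable
  let S : L0 Prs := AEEqFun.mk s hs.aestronglyMeasurable
  have hT : ∀ m, ∀ᵐ ω ∂(qsMeasure Prs), T m ω = t m ω := fun m => AEEqFun.coeFn_mk _ _
  have hS : ∀ᵐ ω ∂(qsMeasure Prs), S ω = s ω := AEEqFun.coeFn_mk _ _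
  have hTb : ∀ m, ∀ᵐ ω ∂(qsMeasure Prs), |T m ω| ≤ c * W ω := fun m => by
    filter_upwards [hT m, hW1] with ω h1 h2
    rw [h1]
    have h3 : W ω ≤ c * W ω := by nlinarith
    by_cases hω : ω ∈ N
    · simp only [t, Set.piecewise_eq_of_mem _ _ _ hω, abs_neg]
      rw [abs_of_nonneg (by linarith)]
    · simp only [t, Set.piecewise_eq_of_notMem _ _ _ hω]
      refine abs_le.2 ⟨le_min (le_max_right _ _) (by linarith), (min_le_right _ _).trans h3⟩
  have hTC : ∀ m, T m ∈ claims W K := fun m => by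
    obtain ⟨-, k, ⟨hk, hck⟩, hXk⟩ := hX m
    refine ⟨(mem_LW_iff hW).2 ⟨c, hTb m⟩, k, hk, ?_⟩
    rw [neg_smul_le_iff] at hck
    rw [← AEEqFun.coeFn_le] at hXk ⊢
    filter_upwards [hT m, hck, hXk] with ω h1 h2 h3
    rw [h1]
    by_cases hω : ω ∈ N
    · simpa only [t, Set.piecewise_eq_of_mem _ _ _ hω] using h2
    · simp only [t, Set.piecewise_eq_of_notMem _ _ _ hω]
      exact (min_le_left _ _).trans (max_le h3 h2)
  have hlimT : ∀ᵐ ω ∂(qsMeasure Prs), Tendsto (fun m => T m ω) atTop (𝓝 (S ω)) := by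
    filter_upwards [ae_all_iff.2 hT, hS, hW1, hf0, hfW] with ω h1 h2 h3 h4 h5
    simp only [h1, h2]
    by_cases hω : ω ∈ N
    · simp only [t, s, Set.piecewise_eq_of_mem _ _ _ hω]
      exact tendsto_const_nhds
    · simp only [t, s, Set.piecewise_eq_of_notMem _ _ _ hω]
      have h6 : f ω = min (max (f ω) (-(c * W ω))) (W ω) := by
        rw [max_eq_left (by nlinarith), min_eq_left h5]
      conv => rhs; rw [h6]
      exact ((hNc ω hω).max tendsto_const_nhds).min tendsto_const_nhds
  obtain ⟨hSW, k, hk, hSk⟩ := hC.2 T S hTC ⟨c, fun m => wNorm_le hW ⟨P, hP⟩ (hTb m)⟩ hlimT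
  -- Fatou closedness gives some `k ∈ K` with no risk bound, but `k ≥ S ≥ -cW` restores it.
  refine ⟨S, ⟨hSW, k, ⟨hk, ?_⟩, hSk⟩, ?_⟩
  · rw [neg_smul_le_iff]
    rw [← AEEqFun.coeFn_le] at hSk
    filter_upwards [hS, hSk, hW1, hf0] with ω h1 h2 h3 h4
    refine le_trans ?_ (h1 ▸ h2)
    by_cases hω : ω ∈ N
    · simp only [s, Set.piecewise_eq_of_mem _ _ _ hω, le_refl]
    · simp only [s, Set.piecewise_eq_of_notMem _ _ _ hω]
      nlinarith
  · filter_upwards [(absolutelyContinuous_qsMeasure hP).ae_le hS,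
      measure_eq_zero_iff_ae_notMem.1 hN0] with ω h1 hω
    rw [h1]
    simp only [s, Set.piecewise_eq_of_notMem _ _ _ hω]

/-! ### Separation in `L²(P)` and the change of measure. -/

/-- A square integrable separating functional for a convex, downward closed set `D ⊆ L_W`, against
an element `f` that is not the `P`-a.s. limit of a sequence in `D`. -/
theorem exists_density_separating {W : L0 Prs} (hW : 1 ≤ W) {P : ProbabilityMeasure Ω}
    (hP : P ∈ Prs) {D : Set (L0 Prs)} (hDW : D ⊆ LW W) (hconv : Convex ℝ D) (h0 : 0 ∈ D)
    (hdown : ∀ X ∈ D, ∀ Y ∈ LW W, Y ≤ X → Y ∈ D) {f : L0 Prs} (hf : f ∈ LW W)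
    (hlim : ∀ X : ℕ → L0 Prs, (∀ m, X m ∈ D) →
      ¬ ∀ᵐ ω ∂(P : Measure Ω), Tendsto (fun m => X m ω) atTop (𝓝 (f ω))) :
    ∃ (g : Ω → ℝ) (u : ℝ), Measurable g ∧ Integrable g (P : Measure Ω) ∧
      0 ≤ᵐ[(P : Measure Ω)] g ∧ 0 < u ∧
      (∀ X ∈ D, ∫ ω, g ω * (X ω / W ω) ∂(P : Measure Ω) < u) ∧
      u < ∫ ω, g ω * (f ω / W ω) ∂(P : Measure Ω) := by
  have hac := absolutelyContinuous_qsMeasure hP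
  have hW1 : ∀ᵐ ω ∂(P : Measure Ω), 1 ≤ W ω := hac.ae_le (ae_one_le hW)
  have hL2 : ∀ X ∈ LW W, MemLp (fun ω => X ω / W ω) 2 (P : Measure Ω) := fun X hX => by
    obtain ⟨m, hm⟩ := (mem_LW_iff hW).1 hX
    refine MemLp.of_bound (X.measurable.div W.measurable).aestronglyMeasurable m ?_
    filter_upwards [hac.ae_le hm, hW1] with ω h1 h2
    rw [Real.norm_eq_abs, abs_div, abs_of_pos (by linarith : 0 < W ω), div_le_iff₀ (by linarith)]
    exact h1
  let S : Set (Lp ℝ 2 (P : Measure Ω)) :=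
    {Y | ∃ X ∈ D, (Y : Ω → ℝ) =ᵐ[(P : Measure Ω)] fun ω => X ω / W ω}
  have hSconv : Convex ℝ S := by
    rintro Y ⟨X, hX, hYX⟩ Y' ⟨X', hX', hYX'⟩ a b ha hb hab
    refine ⟨a • X + b • X', hconv hX hX' ha hb hab, ?_⟩
    filter_upwards [hYX, hYX', Lp.coeFn_add (a • Y) (b • Y'), Lp.coeFn_smul a Y,
      Lp.coeFn_smul b Y', hac.ae_le (AEEqFun.coeFn_add (a • X) (b • X')),
      hac.ae_le (AEEqFun.coeFn_smul a X), hac.ae_le (AEEqFun.coeFn_smul b X')]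
      with ω h1 h2 h3 h4 h5 h6 h7 h8
    rw [h3, h6, Pi.add_apply, Pi.add_apply, h4, h5, h7, h8]
    simp only [Pi.smul_apply, smul_eq_mul, h1, h2]
    ring
  let F : Lp ℝ 2 (P : Measure Ω) := (hL2 f hf).toLp _
  have hF : F ∉ closure S := by
    intro hmem
    obtain ⟨Y, hYS, hY⟩ := mem_closure_iff_seq_limit.1 hmem
    -- An `L²`-convergent sequence has an a.s. convergent subsequence; multiplying by `W`
    -- contradicts `hlim`.
    obtain ⟨φ, -, hφ⟩ := (tendstoInMeasure_of_tendsto_Lp hY).exists_seq_tendsto_ae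
    choose X hXD hYX using hYS
    refine hlim (fun m => X (φ m)) (fun m => hXD _) ?_
    filter_upwards [hφ, ae_all_iff.2 hYX, (hL2 f hf).coeFn_toLp, hW1] with ω h1 h2 h3 h4
    have hpos : W ω ≠ 0 := by linarith
    have h5 := h1.mul_const (W ω)
    simp only [h2, F, h3, div_mul_cancel₀ _ hpos] at h5
    exact h5
  obtain ⟨ℓ, u, hlt, hgt⟩ := geometric_hahn_banach_closed_point hSconv.closure isClosed_closure hF
  let g : Lp ℝ 2 (P : Measure Ω) := (InnerProductSpace.toDual ℝ _).symm ℓ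
  have hℓ : ∀ X (hX : X ∈ LW W), ℓ ((hL2 X hX).toLp _) =
      ∫ ω, g ω * (X ω / W ω) ∂(P : Measure Ω) := fun X hX => by
    rw [← InnerProductSpace.toDual_symm_apply, L2.inner_def]
    refine integral_congr_ae ?_
    filter_upwards [(hL2 X hX).coeFn_toLp] with ω h
    simp only [h]
    exact mul_comm _ _
  have hD : ∀ X ∈ D, ∫ ω, g ω * (X ω / W ω) ∂(P : Measure Ω) < u := fun X hX => by
    rw [← hℓ X (hDW hX)]
    exact hlt _ (subset_closure ⟨X, hX, MemLp.coeFn_toLp _⟩)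
  have hgm : Measurable g := (Lp.stronglyMeasurable g).measurable
  have hgi : Integrable g (P : Measure Ω) := (Lp.memLp g).integrable one_le_two
  have hu : 0 < u := by
    refine (hD 0 h0).trans_le' (le_of_eq ?_)
    rw [← integral_zero Ω ℝ]
    refine integral_congr_ae ?_
    filter_upwards [hac.ae_le (AEEqFun.coeFn_zero (α := Ω) (μ := qsMeasure Prs) (β := ℝ))]
      with ω h
    simp [h]
  refine ⟨g, u, hgm, hgi, ?_, hu, hD, ?_⟩
  -- Downward closedness puts `-rW` on `{g ≤ 0}` into `D` for every `r ≥ 0`. Its pairing with `g` is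
  -- `r ∫ g⁻`, which stays below `u` for all `r` only if `∫ g⁻ = 0`.
  · have hneg : ∀ r : ℝ, 0 ≤ r → r * ∫ ω, max (-g ω) 0 ∂(P : Measure Ω) < u := fun r hr => by
      classical
      let v : Ω → ℝ := {ω | g ω ≤ 0}.indicator fun ω => -(r * W ω)
      have hv : Measurable v := (W.measurable.const_mul r).neg.indicator
        (measurableSet_le hgm measurable_const)
      let V : L0 Prs := AEEqFun.mk v hv.aestronglyMeasurable
      have hV : ∀ᵐ ω ∂(qsMeasure Prs), V ω = v ω := AEEqFun.coeFn_mk _ _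
      have hVD : V ∈ D := by
        refine hdown 0 h0 V ((mem_LW_iff hW).2 ⟨r, ?_⟩) ?_
        · filter_upwards [hV, ae_one_le hW] with ω h1 h2
          have : 0 ≤ r * W ω := mul_nonneg hr (by linarith)
          rw [h1]
          simp only [v, Set.indicator_apply]
          split_ifs
          · rw [abs_neg, abs_of_nonneg this]
          · simpa using this
        · rw [← AEEqFun.coeFn_le]
          filter_upwards [hV, ae_one_le hW,
            AEEqFun.coeFn_zero (α := Ω) (μ := qsMeasure Prs) (β := ℝ)] with ω h1 h2 h3
          have : 0 ≤ r * W ω := mul_nonneg hr (by linarith)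
          rw [h1, h3]
          simp only [v, Set.indicator_apply, Pi.zero_apply]
          split_ifs <;> linarith
      rw [← integral_const_mul]
      refine (hD V hVD).trans_le' (le_of_eq (integral_congr_ae ?_))
      filter_upwards [hac.ae_le hV, hW1] with ω h1 h2
      have hpos : W ω ≠ 0 := by linarith
      rw [h1]
      simp only [v, Set.indicator_apply, Set.mem_ofPred_eq]
      split_ifs with h
      · rw [max_eq_left (by linarith)]
        field_simp
      · rw [max_eq_right (by linarith)]
        simp
    have hnn : 0 ≤ᵐ[(P : Measure Ω)] fun ω => max (-g ω) 0 :=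
      ae_of_all _ fun ω => le_max_right _ _
    have hz : ∫ ω, max (-g ω) 0 ∂(P : Measure Ω) = 0 := by
      refine le_antisymm ?_ (integral_nonneg_of_ae hnn)
      by_contra! hpos
      have := hneg (u / ∫ ω, max (-g ω) 0 ∂(P : Measure Ω)) (by positivity)
      rw [div_mul_cancel₀ _ hpos.ne'] at this
      exact lt_irrefl _ this
    filter_upwards [(integral_eq_zero_iff_of_nonneg_ae hnn hgi.neg.pos_part).1 hz] with ω h
    have h' : max (-g ω) 0 = 0 := h
    have := max_eq_right_iff.1 h'
    simpa using this
  · rw [← hℓ f hf]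
    exact hgt

/-- The normalized form of `exists_density_separating`: the separating functional is the
expectation under a probability measure. -/
theorem exists_PW_separating {W : L0 Prs} (hW : 1 ≤ W) {P : ProbabilityMeasure Ω}
    (hP : P ∈ Prs) {D : Set (L0 Prs)} (hDW : D ⊆ LW W) (hconv : Convex ℝ D) (h0 : 0 ∈ D)
    (hdown : ∀ X ∈ D, ∀ Y ∈ LW W, Y ≤ X → Y ∈ D) {f : L0 Prs} (hf : f ∈ LW W)
    (hlim : ∀ X : ℕ → L0 Prs, (∀ m, X m ∈ D) →
      ¬ ∀ᵐ ω ∂(P : Measure Ω), Tendsto (fun m => X m ω) atTop (𝓝 (f ω))) :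
    ∃ (δ : ℝ) (Q : ProbabilityMeasure Ω), 0 < δ ∧ (Q : Measure Ω) ≪ (P : Measure Ω) ∧ Q ∈ PW W ∧
      (∀ X ∈ D, ∫ ω, X ω ∂(Q : Measure Ω) < δ) ∧ δ < ∫ ω, f ω ∂(Q : Measure Ω) := by
  obtain ⟨g, u, hgm, hgi, hg0, hu, hD, hfu⟩ :=
    exists_density_separating hW hP hDW hconv h0 hdown hf hlim
  have hW1 : ∀ᵐ ω ∂(P : Measure Ω), 1 ≤ W ω :=
    (absolutelyContinuous_qsMeasure hP).ae_le (ae_one_le hW)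
  have hqm : Measurable fun ω => g ω / W ω := hgm.div W.measurable
  have hqi : Integrable (fun ω => g ω / W ω) (P : Measure Ω) := by
    refine hgi.mono hqm.aestronglyMeasurable ?_
    filter_upwards [hW1] with ω h
    rw [norm_div]
    exact div_le_self (norm_nonneg _) (h.trans (le_abs_self _))
  have hq0 : 0 ≤ᵐ[(P : Measure Ω)] fun ω => g ω / W ω := by
    filter_upwards [hW1, hg0] with ω h1 h2
    exact div_nonneg h2 (by linarith)
  set Z := ∫ ω, g ω / W ω ∂(P : Measure Ω) with hZdef
  have hZ : 0 < Z := by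
    refine (integral_nonneg_of_ae hq0).lt_of_ne fun h => ?_
    have hz := (integral_eq_zero_iff_of_nonneg_ae hq0 hqi).1 h.symm
    have : ∫ ω, g ω * (f ω / W ω) ∂(P : Measure Ω) = 0 := by
      rw [← integral_zero Ω ℝ]
      refine integral_congr_ae ?_
      filter_upwards [hz] with ω h
      have h' : g ω / W ω = 0 := h
      rw [mul_div_left_comm, h', mul_zero]
    linarith
  -- Dividing by `W` makes `E_Q[X]` a multiple of the pairing of `g` with `X / W`, and makes `W`
  -- integrable because `W q = g / Z`.
  let q : Ω → NNReal := fun ω => Real.toNNReal (Z⁻¹ * (g ω / W ω))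
  have hq : Measurable q := (hqm.const_mul _).real_toNNReal
  have hqcoe : ∀ᵐ ω ∂(P : Measure Ω), (q ω : ℝ) = Z⁻¹ * (g ω / W ω) := by
    filter_upwards [hq0] with ω h
    exact Real.coe_toNNReal _ (mul_nonneg (inv_nonneg.2 hZ.le) h)
  let ν : Measure Ω := (P : Measure Ω).withDensity fun ω => (q ω : ENNReal)
  have hνprob : IsProbabilityMeasure ν := by
    refine ⟨?_⟩
    rw [withDensity_apply _ MeasurableSet.univ, Measure.restrict_univ]
    change ∫⁻ ω, ENNReal.ofReal (Z⁻¹ * (g ω / W ω)) ∂(P : Measure Ω) = 1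
    rw [← ofReal_integral_eq_lintegral_ofReal (hqi.const_mul _), integral_const_mul, ← hZdef,
      inv_mul_cancel₀ hZ.ne', ENNReal.ofReal_one]
    filter_upwards [hq0] with ω h
    exact mul_nonneg (inv_nonneg.2 hZ.le) h
  have hνac : ν ≪ (P : Measure Ω) := withDensity_absolutelyContinuous _ _
  have hint : ∀ X : L0 Prs, ∫ ω, X ω ∂ν =
      Z⁻¹ * ∫ ω, g ω * (X ω / W ω) ∂(P : Measure Ω) := fun X => by
    rw [integral_withDensity_eq_integral_smul hq, ← integral_const_mul]
    refine integral_congr_ae ?_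
    filter_upwards [hqcoe] with ω h
    rw [NNReal.smul_def, h, smul_eq_mul]
    ring
  refine ⟨Z⁻¹ * u, ⟨ν, hνprob⟩, by positivity, hνac, ⟨⟨P, hP, hνac⟩, ?_⟩, fun X hX => ?_, ?_⟩
  · change Integrable (fun ω => W ω) ν
    rw [integrable_withDensity_iff_integrable_smul hq]
    refine (hgi.const_mul Z⁻¹).congr ?_
    filter_upwards [hqcoe, hW1] with ω h1 h2
    have hpos : W ω ≠ 0 := by linarith
    rw [NNReal.smul_def, h1, smul_eq_mul, mul_assoc, div_mul_cancel₀ _ hpos]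
  · change ∫ ω, X ω ∂ν < _
    rw [hint]
    exact mul_lt_mul_of_pos_left (hD X hX) (inv_pos.2 hZ)
  · change _ < ∫ ω, f ω ∂ν
    rw [hint]
    exact mul_lt_mul_of_pos_left hfu (inv_pos.2 hZ)

/-! ### The two implications. -/

theorem exists_not_isPolar_lt {X : L0 Prs} (h0 : 0 ≤ X) (hne : X ≠ 0) :
    ∃ m : ℕ, ¬ IsPolar Prs {ω | 1 / ((m : ℝ) + 1) < X ω} := by
  by_contra! h
  refine hne (le_antisymm ?_ h0)
  rw [← AEEqFun.coeFn_le]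
  have h' : ∀ m : ℕ, ∀ᵐ ω ∂(qsMeasure Prs), ω ∉ {ω | 1 / ((m : ℝ) + 1) < X ω} := fun m =>
    measure_eq_zero_iff_ae_notMem.1 ((qsMeasure_eq_zero_iff _ _).2 (h m))
  filter_upwards [ae_all_iff.2 h',
    AEEqFun.coeFn_zero (α := Ω) (μ := qsMeasure Prs) (β := ℝ)] with ω h1 h2
  rw [h2, Pi.zero_apply]
  by_contra! hpos
  obtain ⟨m, hm⟩ := exists_nat_one_div_lt hpos
  exact h1 m hm

theorem SensitiveNABR.exists_separating {W : L0 Prs} (hW : 1 ≤ W) {K : PointedCone ℝ (L0 Prs)}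
    (hC : FatouClosed W (claims W (K : Set (L0 Prs))))
    (h : SensitiveNABR W (K : Set (L0 Prs))) {A : Set Ω} (hA : MeasurableSet A)
    (hAp : ¬ IsPolar Prs A) {n : ℕ} (hn : 1 ≤ n) :
    ∃ (δ : ℝ) (Q : ProbabilityMeasure Ω), 0 < δ ∧ δ ≤ 1 / (n : ℝ) ∧ Q ∈ PW W ∧
      (n : ℝ) * δ < (Q : Measure Ω).real A ∧
      ∀ X ∈ sensitiveHull W (claimsBdd W (K : Set (L0 Prs)) (n : ℝ)),
        ∫ ω, X ω ∂(Q : Measure Ω) < δ := by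
  have hn1 : (1 : ℝ) ≤ n := by exact_mod_cast hn
  have hn0 : (0 : ℝ) < n := by linarith
  have hnn : (n : ℝ)⁻¹ ≤ 1 := inv_le_one_of_one_le₀ hn1
  -- The height `1/n` turns `δ < E_Q[f]` into `nδ < Q(A)`; since `Q(A) ≤ 1`, also `δ ≤ 1/n`.
  let φ : Ω → ℝ := A.indicator fun _ => (n : ℝ)⁻¹
  have hφ : Measurable φ := measurable_const.indicator hA
  have hφ0 : ∀ ω, 0 ≤ φ ω := Set.indicator_nonneg fun _ _ => by positivity
  have hφ1 : ∀ ω, φ ω ≤ 1 := fun ω => Set.indicator_le' (fun _ _ => hnn) (fun _ _ => zero_le_one) ω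
  let f : L0 Prs := AEEqFun.mk φ hφ.aestronglyMeasurable
  have hf : ∀ᵐ ω ∂(qsMeasure Prs), f ω = φ ω := AEEqFun.coeFn_mk _ _
  have hfW : ∀ᵐ ω ∂(qsMeasure Prs), f ω ≤ W ω := by
    filter_upwards [hf, ae_one_le hW] with ω h1 h2
    rw [h1]
    exact (hφ1 ω).trans h2
  have hf0 : ∀ᵐ ω ∂(qsMeasure Prs), 0 ≤ f ω := by
    filter_upwards [hf] with ω h1
    rw [h1]
    exact hφ0 ω
  have hfLW : f ∈ LW W := by
    refine (mem_LW_iff hW).2 ⟨1, ?_⟩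
    filter_upwards [hf0, hfW] with ω h1 h2
    rwa [abs_of_nonneg h1, one_mul]
  have hfne : f ≠ 0 := fun hf00 => hAp <| by
    rw [← qsMeasure_eq_zero_iff, measure_eq_zero_iff_ae_notMem]
    rw [hf00] at hf
    filter_upwards [hf, AEEqFun.coeFn_zero (α := Ω) (μ := qsMeasure Prs) (β := ℝ)] with ω h1 h2 hω
    rw [h2] at h1
    simp only [φ, Set.indicator_of_mem hω, Pi.zero_apply] at h1
    exact (inv_pos.2 hn0).ne h1
  have hfplus : f ∈ LInfPlus Prs := by
    refine ⟨⟨1, (forall_measure_lt_abs_eq_zero_iff f 1).2 ?_⟩, ?_⟩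
    · filter_upwards [hf] with ω h1
      rw [h1, abs_of_nonneg (hφ0 ω)]
      exact hφ1 ω
    · rw [← AEEqFun.coeFn_le]
      filter_upwards [hf0, AEEqFun.coeFn_zero (α := Ω) (μ := qsMeasure Prs) (β := ℝ)]
        with ω h1 h2
      rwa [h2]
  have hnot : f ∉ sensitiveHull W (claimsBdd W (K : Set (L0 Prs)) (n : ℝ)) := fun hmem => by
    have : f ∈ ({0} : Set (L0 Prs)) := by
      rw [← h]
      exact ⟨Set.mem_iUnion.2 ⟨⟨n, hn0.le⟩, hmem⟩, hfplus⟩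
    exact hfne this
  obtain ⟨P, hPf⟩ : ∃ P : Prs, f ∉ proj P ⁻¹' (proj P '' claimsBdd W (K : Set (L0 Prs)) (n : ℝ)) := by
    by_contra! hall
    exact hnot ⟨hfLW, hall⟩
  obtain ⟨δ, Q, hδ, hQP, hQ, hQD, hQf⟩ := exists_PW_separating hW P.2
    (claimsBdd_subset_LW W (K : Set (L0 Prs)) n) (convex_claimsBdd hW K n)
    (zero_mem_claimsBdd hW K hn0.le) (fun X hX Y hY hYX => claimsBdd_of_le hX hY hYX) hfLW
    (fun X hX hXlim => by
      obtain ⟨T, hT, hfT⟩ := exists_mem_claimsBdd_ae_eq_of_tendsto hW hC P.2 hn1 hX hf0 hfW hXlim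
      exact hPf ⟨T, hT, (proj_eq_proj_iff P T f).2 hfT.symm⟩)
  have hQfA : ∫ ω, f ω ∂(Q : Measure Ω) = (Q : Measure Ω).real A * (n : ℝ)⁻¹ := by
    have : (fun ω => f ω) =ᵐ[(Q : Measure Ω)] φ :=
      (hQP.trans (absolutelyContinuous_qsMeasure P.2)).ae_le hf
    rw [integral_congr_ae this, integral_indicator_const _ hA, smul_eq_mul]
  have hA1 : (Q : Measure Ω).real A ≤ 1 := measureReal_le_one
  have hlt : (n : ℝ) * δ < (Q : Measure Ω).real A := by
    rw [hQfA, ← div_eq_mul_inv, lt_div_iff₀ hn0] at hQf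
    linarith
  refine ⟨δ, Q, hδ, ?_, hQ, hlt, fun X hX => ?_⟩
  · rw [le_div_iff₀ hn0]
    linarith
  -- The bound passes to the hull since its elements agree `P`-a.s. with elements of `𝒞_n` and `Q ≪
  -- P`.
  · obtain ⟨Y, hY, hYX⟩ := hX.2 P
    rw [← integral_congr_ae (hQP.ae_le ((proj_eq_proj_iff P Y X).1 hYX))]
    exact hQD Y hY

end QuasiSure

theorem theorem5p9 {Ω : Type*} [MeasurableSpace Ω] (Prs : Set (ProbabilityMeasure Ω))
    (W : L0 Prs) (hW : 1 ≤ W) (K : PointedCone ℝ (L0 Prs))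
    (hC : FatouClosed W (claims W (K : Set (L0 Prs)))) :
    SensitiveNABR W (K : Set (L0 Prs)) ↔
      ∀ A : Set Ω, MeasurableSet A → ¬ IsPolar Prs A → ∀ n : ℕ, 1 ≤ n →
        ∃ (δ : ℝ) (Q : ProbabilityMeasure Ω), 0 < δ ∧ δ ≤ 1 / (n : ℝ) ∧ Q ∈ PW W ∧
          (n : ℝ) * δ < (Q : Measure Ω).real A ∧
          ∀ X ∈ sensitiveHull W (claimsBdd W (K : Set (L0 Prs)) (n : ℝ)),
            ∫ ω, X ω ∂(Q : Measure Ω) < δ := by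
  refine ⟨fun h A hA hAp n hn => h.exists_separating hW hC hA hAp hn, fun h => ?_⟩
  refine Set.eq_singleton_iff_unique_mem.2 ⟨⟨?_, ?_⟩, ?_⟩
  · exact Set.mem_iUnion.2 ⟨⟨0, le_rfl⟩,
      subset_sensitiveHull (claimsBdd_subset_LW _ _ _) (zero_mem_claimsBdd hW K le_rfl)⟩
  · refine ⟨⟨0, (forall_measure_lt_abs_eq_zero_iff 0 0).2 ?_⟩, le_rfl⟩
    filter_upwards [AEEqFun.coeFn_zero (α := Ω) (μ := qsMeasure Prs) (β := ℝ)] with ω h1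
    simp [h1]
  · rintro X ⟨hX, -, hX0⟩
    obtain ⟨⟨c, hc⟩, hXc⟩ := Set.mem_iUnion.1 hX
    by_contra hne
    obtain ⟨m, hm⟩ := exists_not_isPolar_lt hX0 hne
    have hA : MeasurableSet {ω | 1 / ((m : ℝ) + 1) < X ω} :=
      measurableSet_lt measurable_const X.measurable
    obtain ⟨N, hN⟩ := exists_nat_ge c
    -- `n ≥ c` places `X` in the hull of `𝒞_n`, and `n ≥ m + 1` closes the chain `Q(A) ≤ (m+1)
    -- E_Q[X] < (m+1) δ ≤ nδ < Q(A)`.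
    let n := max N (m + 1)
    have hcn : c ≤ (n : ℝ) := hN.trans (by exact_mod_cast le_max_left _ _)
    have hmn : (m : ℝ) + 1 ≤ n := by exact_mod_cast le_max_right N (m + 1)
    obtain ⟨δ, Q, hδ, -, hQ, hQA, hQX⟩ :=
      h _ hA hm n ((Nat.le_add_left 1 m).trans (le_max_right _ _))
    have hlt := hQX X (sensitiveHull_mono W (claimsBdd_mono hW _ hcn) hXc)
    obtain ⟨⟨P, hP, hQP⟩, -⟩ := id hQ
    have hX0' : 0 ≤ᵐ[(Q : Measure Ω)] fun ω => X ω := by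
      refine (hQP.trans (absolutelyContinuous_qsMeasure hP)).ae_le ?_
      filter_upwards [AEEqFun.coeFn_le.2 hX0,
        AEEqFun.coeFn_zero (α := Ω) (μ := qsMeasure Prs) (β := ℝ)] with ω h1 h2
      rwa [h2] at h1
    have hmarkov := mul_meas_ge_le_integral_of_nonneg hX0' (integrable_of_mem_LW hW hXc.1 hQ)
      (1 / ((m : ℝ) + 1))
    have hmono : (Q : Measure Ω).real {ω | 1 / ((m : ℝ) + 1) < X ω} ≤
        (Q : Measure Ω).real {ω | 1 / ((m : ℝ) + 1) ≤ X ω} :=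
      measureReal_mono (Set.ofPred_subset_ofPred.2 fun _ hω => le_of_lt hω)
    have hm0 : (0 : ℝ) < (m : ℝ) + 1 := by positivity
    have h1 : (Q : Measure Ω).real {ω | 1 / ((m : ℝ) + 1) ≤ X ω} ≤
        ((m : ℝ) + 1) * ∫ ω, X ω ∂(Q : Measure Ω) := by
      rwa [one_div_mul_eq_div, div_le_iff₀' hm0] at hmarkov
    nlinarith
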